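/- Let $(\pi_\epsilon)_{\epsilon>0}$ be a family of discrete probability distributions on $\mathbb{R}$, each with zero mean, unit variance and finite entropy $H_\epsilon=\sum_x \pi_\epsilon(\{x\})\log\frac{1}{\pi_\epsilon(\{x\})}$ (natural logarithm). For $s\ge 0$ let $$I_\epsilon(s)=I(\beta_0;\sqrt{s}\,\beta_0+N),\qquad M_\epsilon(s)=\mathbb{E}\big[(\beta_0-\mathbb{E}[\beta_0\mid \sqrt{s}\,\beta_0+N])^2\big],$$ where $\beta_0\sim\pi_\epsilon$ and $N\sim\mathcal{N}(0,1)$ are independent, and $I(\cdot\,;\cdot)$ denotes mutual information (in nats). Assume that $$\lim_{\epsilon\to0}M_\epsilon(2H_\epsilon t)=\begin{cases}1, & t\in[0,1),\\ 0, & t\in(1,\infty).\end{cases}$$ For each $\epsilon>0$ let $\delta_\epsilon,\mathrm{snr}_\epsilon\in(0,\infty)$, and let $$\delta_{\epsilon,\mathrm{MMSE}}=\frac{2H_\epsilon}{\log(1+\mathrm{snr}_\epsilon)},\qquad \mathcal{F}_\epsilon(s)=I_\epsilon(s)+\frac{\delta_\epsilon}{2}\,\phi\!\left(\frac{s}{\delta_\epsilon\,\mathrm{snr}_\epsilon}\right)\quad(s>0),\qquad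 \phi(x)=x-\log x-1.$$ Let $r\in(0,1)\cup(1,\infty)$ and assume that $\lim_{\epsilon\to0}\delta_\epsilon/\delta_{\epsilon,\mathrm{MMSE}}=r$. Then for every $\epsilon>0$ the function $\mathcal{F}_\epsilon$ attains its minimum over $(0,\infty)$, and the set of its minimizers has a smallest element $\underline{s}^*_\epsilon$ and a largest element $\overline{s}^*_\epsilon$. Moreover, as $\epsilon\to0$, $$r\in(0,1)\ \Longrightarrow\ \lim_{\epsilon\to0}M_\epsilon(\overline{s}^*_\epsilon)=1,\qquad r\in(1,\infty)\ \Longrightarrow\ \lim_{\epsilon\to0}M_\epsilon(\underline{s}^*_\epsilon)=0.$$ -/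

import Mathlib

open MeasureTheory ProbabilityTheory Filter Topology

namespace AllOrNothing

noncomputable section

/-- Mutual information `I(X; Y)`, in nats: the Kullback-Leibler divergence of the joint law of
`(X, Y)` from the product of its marginals. -/
def mutualInfo {Ω : Type*} [MeasurableSpace Ω] (X Y : Ω → ℝ) (μ : Measure Ω) : ℝ :=
  (InformationTheory.klDiv (μ.map (fun ω => (X ω, Y ω))) ((μ.map X).prod (μ.map Y))).toReal

/-- Minimum mean-squared error `E[(X - E[X | Y])²]` of estimating `X` from `Y`. -/
def mmse {Ω : Type*} [MeasurableSpace Ω] (X Y : Ω → ℝ) (μ : Measure Ω) : ℝ :=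
  ∫ ω, (X ω - (μ[X | MeasurableSpace.comap Y inferInstance]) ω) ^ 2 ∂μ

/-- Joint law of `(β₀, N)`, with `β₀ ∼ π` and `N ∼ 𝒩(0, 1)` independent. -/
def channelLaw (π : Measure ℝ) : Measure (ℝ × ℝ) := π.prod (gaussianReal 0 1)

/-- Output `√s β₀ + N` of the single-letter channel, as a function of `(β₀, N)`. -/
def channelOutput (s : ℝ) (z : ℝ × ℝ) : ℝ := √s * z.1 + z.2

/-- Mutual information function `I(s)` of the single-letter channel. -/
def miFun (π : Measure ℝ) (s : ℝ) : ℝ := mutualInfo Prod.fst (channelOutput s) (channelLaw π)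

/-- MMSE function `M(s)` of the single-letter channel. -/
def mmseFun (π : Measure ℝ) (s : ℝ) : ℝ := mmse Prod.fst (channelOutput s) (channelLaw π)

/-- Shannon entropy `H(π) = ∑ₓ π{x} log (1 / π{x})` (in nats) of a discrete distribution `π`. -/
def entropy (π : Measure ℝ) : ℝ := ∑' x : ℝ, Real.negMulLog (π.real {x})

/-- `π` is a (discrete) probability distribution on `ℝ` with zero mean, unit variance and finite
entropy. -/
structure IsCoeffDistribution (π : Measure ℝ) : Prop where
  isProbabilityMeasure : IsProbabilityMeasure π
  discrete : ∃ S : Set ℝ, S.Countable ∧ π Sᶜ = 0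
  finite_entropy : Summable (fun x : ℝ => Real.negMulLog (π.real {x}))
  memLp : MemLp (fun x : ℝ => x) 2 π
  mean : ∫ x, x ∂π = 0
  variance : Var[fun x : ℝ => x; π] = 1

/-- The rescaled MMSE functions `t ↦ M_ε(2 H_ε t)` converge pointwise, as `ε → 0⁺`, to the step
function jumping from `1` to `0` at `t = 1`. -/
def StepConvergence (π : ℝ → Measure ℝ) : Prop :=
  (∀ t : ℝ, 0 ≤ t → t < 1 →
    Tendsto (fun ε => mmseFun (π ε) (2 * entropy (π ε) * t)) (𝓝[>] 0) (𝓝 1)) ∧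
  (∀ t : ℝ, 1 < t →
    Tendsto (fun ε => mmseFun (π ε) (2 * entropy (π ε) * t)) (𝓝[>] 0) (𝓝 0))

/-- `φ(x) = x - log x - 1`. -/
def phi (x : ℝ) : ℝ := x - Real.log x - 1

/-- The replica-symmetric potential `F(s) = I(s) + (δ / 2) φ(s / (δ snr))`, for `s > 0`. -/
def rsPotential (π : Measure ℝ) (δ snr s : ℝ) : ℝ :=
  miFun π s + δ / 2 * phi (s / (δ * snr))

/-- The set of minimizers of the potential over `(0, ∞)` (at `s = 0` the potential is `+∞`). -/
def rsMinimizers (π : Measure ℝ) (δ snr : ℝ) : Set ℝ :=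
  {s | 0 < s ∧ ∀ u : ℝ, 0 < u → rsPotential π δ snr s ≤ rsPotential π δ snr u}

/-- The smallest minimizer of the potential. -/
def sLower (π : Measure ℝ) (δ snr : ℝ) : ℝ := sInf (rsMinimizers π δ snr)

/-- The largest minimizer of the potential. -/
def sUpper (π : Measure ℝ) (δ snr : ℝ) : ℝ := sSup (rsMinimizers π δ snr)

/-- The critical threshold `2 H(π) / log (1 + snr)`. -/
def deltaMMSE (π : Measure ℝ) (snr : ℝ) : ℝ := 2 * entropy π / Real.log (1 + snr)

end

end AllOrNothing

/-! Write `H` for the entropy and `ρ` for `δ / deltaMMSE`. The proof needs only four bounds on the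
mutual information `I`: it is nondecreasing, grows at rate at most `1/2`, never exceeds `H`, and
satisfies `I(s) ≥ (s/2) M(s)`. Since `M(2Ht) → 1` for `t < 1`, they force `I(2Ht)/H → min(t, 1)`.

As `(δ/2) log(1 + snr) = ρH`, the test points `δ snr/(1 + snr)` and `δ snr` show `min F ≤ H min(ρ,
1)`. If `r < 1`, a minimizer `s ≥ 2Ht` with `r < t < 1` would have `F(s) ≥ I(2Ht) ≈ tH > ρH`
(`lt_of_ratio_lt`). If `r > 1`, a tangent line of `φ` gives `F(s) ≥ I(s) - s/2 + ρH`, where `I(s) -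
s/2` is nonincreasing; a minimizer `s ≤ 2Ht'` with `1 < t' < r` would then have `F(s)` at least
about `(1 - t' + ρ)H > H` (`lt_of_lt_ratio`). Monotonicity of `M` turns these locations into the two
limits.

The growth bounds on `I` avoid differentiation: Gibbs' variational inequality yields the tangent
inequality `mul_mmse_le_mutualInfo_sub`, which is summed over fine subdivisions by
`le_of_sub_le_sq`. Monotonicity of `M` is degradation of the channel (`mmse_antitone_gain`), and `I
≤ H` holds because the posterior density at an atom `x` is at most `1/π{x}` (`miFun_le_entropy`). -/

namespace AllOrNothing

/-! ### Bayes' formula for the Gaussian channel -/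

/-- Exponent of the Gaussian likelihood of the observation `y` given the signal `x`, at gain `a`. -/
noncomputable def logLik (a y x : ℝ) : ℝ := -(y - a * x) ^ 2 / 2

/-- Unnormalised density of the observation of a signal with law `π` at gain `a`. -/
noncomputable def evidence (π : Measure ℝ) (a y : ℝ) : ℝ := ∫ x, Real.exp (logLik a y x) ∂π

/-- Density with respect to the prior of the posterior law of the signal. -/
noncomputable def posteriorDensity (π : Measure ℝ) (a y x : ℝ) : ℝ :=
  Real.exp (logLik a y x) / evidence π a y

/-- Joint law of the signal and the observation at gain `a`. -/
noncomputable def jointLaw (π : Measure ℝ) (a : ℝ) : Measure (ℝ × ℝ) :=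
  (channelLaw π).map (fun z => (z.1, a * z.1 + z.2))

/-- Law of the observation at gain `a`. -/
noncomputable def outputLaw (π : Measure ℝ) (a : ℝ) : Measure ℝ :=
  (channelLaw π).map (fun z => a * z.1 + z.2)

instance (π : Measure ℝ) [IsProbabilityMeasure π] : IsProbabilityMeasure (channelLaw π) := by
  unfold channelLaw; infer_instance

instance (π : Measure ℝ) [IsProbabilityMeasure π] (a : ℝ) : IsProbabilityMeasure (jointLaw π a) :=
  Measure.isProbabilityMeasure_map (by fun_prop)

instance (π : Measure ℝ) [IsProbabilityMeasure π] (a : ℝ) : IsProbabilityMeasure (outputLaw π a) :=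
  Measure.isProbabilityMeasure_map (by fun_prop)

section Density

variable (π : Measure ℝ) [IsProbabilityMeasure π] (a : ℝ)

lemma measurable_logLik : Measurable (fun p : ℝ × ℝ => logLik a p.2 p.1) := by
  unfold logLik; fun_prop

lemma measurable_logLik_right (y : ℝ) : Measurable (logLik a y) := by
  unfold logLik; fun_prop

lemma exp_logLik_le_one (y x : ℝ) : Real.exp (logLik a y x) ≤ 1 := by
  rw [Real.exp_le_one_iff, logLik]
  nlinarith [sq_nonneg (y - a * x)]

lemma integrable_exp_logLik (y : ℝ) : Integrable (fun x => Real.exp (logLik a y x)) π := by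
  refine Integrable.of_bound (C := 1)
    (measurable_logLik_right a y).exp.aestronglyMeasurable (ae_of_all _ fun x => ?_)
  rw [Real.norm_eq_abs, abs_of_pos (Real.exp_pos _)]
  exact exp_logLik_le_one a y x

lemma evidence_pos (y : ℝ) : 0 < evidence π a y :=
  integral_exp_pos (integrable_exp_logLik π a y)

lemma evidence_le_one (y : ℝ) : evidence π a y ≤ 1 := by
  calc evidence π a y ≤ ∫ _, (1 : ℝ) ∂π :=
        integral_mono (integrable_exp_logLik π a y) (integrable_const _)
          (fun x => exp_logLik_le_one a y x)
    _ = 1 := by simp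

lemma measurable_evidence : Measurable (evidence π a) := by
  have h : StronglyMeasurable (Function.uncurry fun y x : ℝ => Real.exp (logLik a y x)) := by
    apply Measurable.stronglyMeasurable
    exact ((measurable_logLik a).comp measurable_swap).exp
  exact h.integral_prod_right.measurable

lemma posteriorDensity_pos (y x : ℝ) : 0 < posteriorDensity π a y x :=
  div_pos (Real.exp_pos _) (evidence_pos π a y)

lemma measurable_posteriorDensity :
    Measurable (fun p : ℝ × ℝ => posteriorDensity π a p.2 p.1) :=
  (measurable_logLik a).exp.div ((measurable_evidence π a).comp measurable_snd)

lemma lintegral_posteriorDensity (y : ℝ) :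
    ∫⁻ x, ENNReal.ofReal (posteriorDensity π a y x) ∂π = 1 := by
  have hi : Integrable (posteriorDensity π a y) π := (integrable_exp_logLik π a y).div_const _
  rw [← ofReal_integral_eq_lintegral_ofReal hi
    (ae_of_all _ fun x => (posteriorDensity_pos π a y x).le)]
  have : ∫ x, posteriorDensity π a y x ∂π = 1 := by
    simp only [posteriorDensity]
    rw [integral_div]
    exact div_self (evidence_pos π a y).ne'
  rw [this, ENNReal.ofReal_one]

lemma gaussianPDFReal_sub_mul (y x : ℝ) :
    gaussianPDFReal 0 1 (y - a * x) = (√(2 * Real.pi))⁻¹ * Real.exp (logLik a y x) := by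
  simp [gaussianPDFReal, logLik]

lemma lintegral_jointLaw (ρ : Measure ℝ) (a : ℝ) {F : ℝ × ℝ → ENNReal} (hF : Measurable F) :
    ∫⁻ p, F p ∂(jointLaw ρ a) =
      ∫⁻ x, (∫⁻ y, gaussianPDF 0 1 (y - a * x) * F (x, y)) ∂ρ := by
  rw [jointLaw, lintegral_map hF (by fun_prop), channelLaw, lintegral_prod _ (by fun_prop)]
  refine lintegral_congr fun x => ?_
  rw [gaussianReal_of_var_ne_zero _ one_ne_zero, lintegral_withDensity_eq_lintegral_mul _
    (measurable_gaussianPDF _ _) (by fun_prop)]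
  rw [← lintegral_add_right_eq_self (μ := volume) _ (-(a * x))]
  refine lintegral_congr fun y => ?_
  simp [sub_eq_add_neg]

lemma lintegral_outputLaw {F : ℝ → ENNReal} (hF : Measurable F) :
    ∫⁻ y, F y ∂(outputLaw π a) =
      ∫⁻ y, ENNReal.ofReal ((√(2 * Real.pi))⁻¹ * evidence π a y) * F y := by
  have hF' : Measurable (fun p : ℝ × ℝ => F p.2) := hF.comp measurable_snd
  have h1 : ∫⁻ y, F y ∂(outputLaw π a) = ∫⁻ p, F p.2 ∂(jointLaw π a) := by
    rw [jointLaw, outputLaw, lintegral_map hF (by fun_prop),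
      lintegral_map hF' (by fun_prop)]
  have hg : Measurable (fun p : ℝ × ℝ => gaussianPDF 0 1 (p.2 - a * p.1)) :=
    (measurable_gaussianPDF 0 1).comp (by fun_prop)
  rw [h1, lintegral_jointLaw π a hF', lintegral_lintegral_swap]
  · refine lintegral_congr fun y => ?_
    change ∫⁻ x, gaussianPDF 0 1 (y - a * x) * F y ∂π = _
    rw [lintegral_mul_const]
    · congr 1
      simp only [gaussianPDF, gaussianPDFReal_sub_mul]
      rw [← ofReal_integral_eq_lintegral_ofReal ((integrable_exp_logLik π a y).const_mul _)
        (ae_of_all _ fun x => by positivity), integral_const_mul, evidence]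
    · exact (measurable_gaussianPDF 0 1).comp (by fun_prop)
  · exact (hg.mul hF').aemeasurable

/-- Bayes' rule. The Gaussian normalising constant, left out of `evidence`, sits in the output law
and cancels. -/
lemma jointLaw_eq_withDensity :
    jointLaw π a = (π.prod (outputLaw π a)).withDensity
      (fun p => ENNReal.ofReal (posteriorDensity π a p.2 p.1)) := by
  have hk := (measurable_posteriorDensity π a).ennreal_ofReal
  refine Measure.ext_of_lintegral _ fun F hF => ?_
  rw [lintegral_jointLaw π a hF, lintegral_withDensity_eq_lintegral_mul _ hk hF,
    lintegral_prod _ (hk.mul hF).aemeasurable]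
  refine lintegral_congr fun x => ?_
  rw [lintegral_outputLaw π a]
  · refine lintegral_congr fun y => ?_
    rw [Pi.mul_apply, ← mul_assoc, ← ENNReal.ofReal_mul
      (mul_nonneg (by positivity) (evidence_pos π a y).le), gaussianPDF, gaussianPDFReal_sub_mul,
      posteriorDensity, mul_assoc, mul_div_cancel₀ _ (evidence_pos π a y).ne']
  · exact (hk.mul hF).comp (by fun_prop : Measurable fun y : ℝ => (x, y))

lemma mutualInfo_eq_integral :
    mutualInfo Prod.fst (fun z => a * z.1 + z.2) (channelLaw π) =
      ∫ z, Real.log (posteriorDensity π a (a * z.1 + z.2) z.1) ∂(channelLaw π) := by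
  have hk := (measurable_posteriorDensity π a).ennreal_ofReal
  have hfst : (channelLaw π).map Prod.fst = π := by
    simp [channelLaw]
  have h1 : (channelLaw π).map (fun z : ℝ × ℝ => (z.1, a * z.1 + z.2)) = jointLaw π a := rfl
  have h2 : (channelLaw π).map (fun z : ℝ × ℝ => a * z.1 + z.2) = outputLaw π a := rfl
  have hac : jointLaw π a ≪ π.prod (outputLaw π a) := by
    rw [jointLaw_eq_withDensity]; exact withDensity_absolutelyContinuous _ _
  -- If the log-likelihood ratio were not integrable, both sides would be `0`, so integrability is
  -- not needed here.
  rw [mutualInfo, h1, h2, hfst, InformationTheory.toReal_klDiv_of_measure_eq hac (by simp)]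
  have hd : ∀ᵐ p ∂(jointLaw π a), llr (jointLaw π a) (π.prod (outputLaw π a)) p
      = Real.log (posteriorDensity π a p.2 p.1) := by
    refine hac.ae_le ?_
    have := Measure.rnDeriv_withDensity (π.prod (outputLaw π a)) hk
    rw [← jointLaw_eq_withDensity] at this
    filter_upwards [this] with p hp
    rw [llr, hp, ENNReal.toReal_ofReal (posteriorDensity_pos π a _ _).le]
  rw [integral_congr_ae hd, jointLaw, integral_map (by fun_prop)]
  exact (measurable_posteriorDensity π a).log.aestronglyMeasurable

end Density

/-! ### Posterior samples and the Nishimori identity -/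

/-- Posterior law of the signal given the observation `y` at gain `a`. -/
noncomputable def posteriorLaw (π : Measure ℝ) (a y : ℝ) : Measure ℝ := π.tilted (logLik a y)

/-- Joint law of the signal, the noise and an independent sample from the posterior. -/
noncomputable def replicaLaw (π : Measure ℝ) (a : ℝ) : Measure ((ℝ × ℝ) × ℝ) :=
  ((channelLaw π).prod π).withDensity
    (fun p => ENNReal.ofReal (posteriorDensity π a (a * p.1.1 + p.1.2) p.2))

section Replica

variable (π : Measure ℝ) [IsProbabilityMeasure π] (a : ℝ)

instance (y : ℝ) : IsProbabilityMeasure (posteriorLaw π a y) :=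
  isProbabilityMeasure_tilted (integrable_exp_logLik π a y)

lemma measurable_posteriorDensity_replica :
    Measurable (fun p : (ℝ × ℝ) × ℝ => posteriorDensity π a (a * p.1.1 + p.1.2) p.2) :=
  (measurable_posteriorDensity π a).comp
    (g := fun p : ℝ × ℝ => posteriorDensity π a p.2 p.1)
    (f := fun p : (ℝ × ℝ) × ℝ => (p.2, a * p.1.1 + p.1.2)) (by fun_prop)

lemma lintegral_replicaLaw {F : (ℝ × ℝ) × ℝ → ENNReal} (hF : Measurable F) :
    ∫⁻ p, F p ∂(replicaLaw π a) =
      ∫⁻ z, ∫⁻ x, ENNReal.ofReal (posteriorDensity π a (a * z.1 + z.2) x) * F (z, x) ∂π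
        ∂(channelLaw π) := by
  have hk := (measurable_posteriorDensity_replica π a).ennreal_ofReal
  rw [replicaLaw, lintegral_withDensity_eq_lintegral_mul _ hk hF,
    lintegral_prod _ (hk.mul hF).aemeasurable]
  rfl

lemma replicaLaw_map_fst : (replicaLaw π a).map Prod.fst = channelLaw π := by
  refine Measure.ext_of_lintegral _ fun F hF => ?_
  have hF' : Measurable (fun p : (ℝ × ℝ) × ℝ => F p.1) := hF.comp measurable_fst
  rw [lintegral_map hF measurable_fst, lintegral_replicaLaw π a hF']
  refine lintegral_congr fun z => ?_
  have hm : Measurable (posteriorDensity π a (a * z.1 + z.2)) :=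
    (measurable_logLik_right a _).exp.div_const _
  change ∫⁻ x, ENNReal.ofReal (posteriorDensity π a (a * z.1 + z.2) x) * F z ∂π = F z
  rw [lintegral_mul_const _ hm.ennreal_ofReal, lintegral_posteriorDensity, one_mul]

/-- Nishimori identity: given the observation, a posterior sample is distributed as the signal
itself. -/
lemma replicaLaw_map_resample :
    (replicaLaw π a).map (fun p => (p.2, a * p.1.1 + p.1.2)) = jointLaw π a := by
  refine Measure.ext_of_lintegral _ fun F hF => ?_
  have hF' : Measurable (fun p : (ℝ × ℝ) × ℝ => F (p.2, a * p.1.1 + p.1.2)) :=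
    hF.comp (by fun_prop)
  have hk := (measurable_posteriorDensity π a).ennreal_ofReal
  have hG : Measurable (fun y : ℝ => ∫⁻ x, ENNReal.ofReal (posteriorDensity π a y x) * F (x, y) ∂π) :=
    (hk.mul hF).lintegral_prod_left'
  rw [lintegral_map hF (by fun_prop), lintegral_replicaLaw π a hF', jointLaw_eq_withDensity,
    lintegral_withDensity_eq_lintegral_mul _ hk hF, lintegral_prod_symm _ (hk.mul hF).aemeasurable,
    outputLaw]
  exact (lintegral_map hG (by fun_prop)).symm

instance : IsProbabilityMeasure (replicaLaw π a) := by
  have : IsProbabilityMeasure ((replicaLaw π a).map Prod.fst) := by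
    rw [replicaLaw_map_fst]; infer_instance
  exact Measure.isProbabilityMeasure_of_map (f := Prod.fst)

lemma integrable_replicaLaw_iff {f : (ℝ × ℝ) × ℝ → ℝ} :
    Integrable f (replicaLaw π a) ↔
      Integrable (fun p => posteriorDensity π a (a * p.1.1 + p.1.2) p.2 * f p)
        ((channelLaw π).prod π) := by
  have hm := measurable_posteriorDensity_replica π a
  rw [replicaLaw, integrable_withDensity_iff_integrable_smul' hm.ennreal_ofReal
    (ae_of_all _ fun _ => ENNReal.ofReal_lt_top)]
  refine integrable_congr (ae_of_all _ fun p => ?_)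
  simp only [ENNReal.toReal_ofReal (posteriorDensity_pos π a _ _).le, smul_eq_mul]

lemma integral_posteriorLaw (ρ : Measure ℝ) (a y : ℝ) (f : ℝ → ℝ) :
    ∫ x, f x ∂(posteriorLaw ρ a y) = ∫ x, posteriorDensity ρ a y x * f x ∂ρ := by
  rw [posteriorLaw, integral_tilted]; rfl

lemma integral_replicaLaw {f : (ℝ × ℝ) × ℝ → ℝ} (hf : Integrable f (replicaLaw π a)) :
    ∫ p, f p ∂(replicaLaw π a) =
      ∫ z, ∫ x, f (z, x) ∂(posteriorLaw π a (a * z.1 + z.2)) ∂(channelLaw π) := by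
  have hm := measurable_posteriorDensity_replica π a
  have hi := (integrable_replicaLaw_iff π a).1 hf
  simp only [integral_posteriorLaw]
  rw [replicaLaw, integral_withDensity_eq_integral_toReal_smul hm.ennreal_ofReal
    (ae_of_all _ fun _ => ENNReal.ofReal_lt_top)]
  simp only [ENNReal.toReal_ofReal (posteriorDensity_pos π a _ _).le, smul_eq_mul]
  exact integral_prod _ hi

lemma integrable_integral_posteriorLaw {f : (ℝ × ℝ) × ℝ → ℝ} (hf : Integrable f (replicaLaw π a)) :
    Integrable (fun z => ∫ x, f (z, x) ∂(posteriorLaw π a (a * z.1 + z.2))) (channelLaw π) := by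
  simp only [integral_posteriorLaw]
  exact ((integrable_replicaLaw_iff π a).1 hf).integral_prod_left

end Replica

/-! ### Optimality of the conditional mean and degradation of the channel -/

lemma mmse_nonneg {Ω : Type*} [MeasurableSpace Ω] {P : Measure Ω} {X Y : Ω → ℝ} :
    0 ≤ mmse X Y P := integral_nonneg fun _ => sq_nonneg _

section Mmse

variable {Ω : Type*} [mΩ : MeasurableSpace Ω] {P : Measure Ω} [IsProbabilityMeasure P] {X Y : Ω → ℝ}

lemma integral_mul_condExp_comap (hX : MemLp X 2 P) (hY : Measurable Y) {g : Ω → ℝ}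
    (hg : StronglyMeasurable[MeasurableSpace.comap Y inferInstance] g) (hg2 : MemLp g 2 P) :
    ∫ ω, g ω * (P[X | MeasurableSpace.comap Y inferInstance]) ω ∂P = ∫ ω, g ω * X ω ∂P := by
  have h1 := condExp_mul_of_stronglyMeasurable_left hg (hg2.integrable_mul hX)
    (hX.integrable one_le_two)
  have h2 := integral_condExp (μ := P) (f := g * X) hY.comap_le
  rw [integral_congr_ae h1] at h2
  exact h2

lemma mmse_eq (hX : MemLp X 2 P) (hY : Measurable Y) :
    mmse X Y P = ∫ ω, X ω ^ 2 ∂P -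
      ∫ ω, (P[X | MeasurableSpace.comap Y inferInstance]) ω * X ω ∂P := by
  set Z := P[X | MeasurableSpace.comap Y inferInstance] with hZ
  have hZ2 : MemLp Z 2 P := hX.condExp (by norm_num)
  have h := integral_mul_condExp_comap hX hY stronglyMeasurable_condExp hZ2
  have e : ∀ ω, (X ω - Z ω) ^ 2 = X ω ^ 2 - 2 * (Z ω * X ω) + Z ω * Z ω := fun ω => by ring
  have i1 : Integrable (fun ω => X ω ^ 2) P := hX.integrable_sq
  have i2 : Integrable (fun ω => 2 * (Z ω * X ω)) P := (hZ2.integrable_mul hX).const_mul 2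
  have i3 : Integrable (fun ω => Z ω * Z ω) P := hZ2.integrable_mul hZ2
  have i12 : Integrable (fun ω => X ω ^ 2 - 2 * (Z ω * X ω)) P := i1.sub i2
  rw [← hZ] at h
  unfold mmse
  rw [← hZ]
  simp only [e]
  rw [integral_add i12 i3, integral_sub i1 i2, integral_const_mul, h]
  ring

lemma mmse_le (hX : MemLp X 2 P) (hY : Measurable Y) {f : ℝ → ℝ} (hf : Measurable f)
    (hf2 : MemLp (fun ω => f (Y ω)) 2 P) :
    mmse X Y P ≤ ∫ ω, (X ω - f (Y ω)) ^ 2 ∂P := by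
  set Z := P[X | MeasurableSpace.comap Y inferInstance] with hZ
  have hZ2 : MemLp Z 2 P := hX.condExp (by norm_num)
  have hfm : StronglyMeasurable[MeasurableSpace.comap Y inferInstance] (fun ω => f (Y ω)) :=
    (hf.comp (comap_measurable Y)).stronglyMeasurable
  have hD2 : MemLp (fun ω => Z ω - f (Y ω)) 2 P := hZ2.sub hf2
  have h := integral_mul_condExp_comap hX hY (stronglyMeasurable_condExp.sub hfm) hD2
  rw [← hZ] at h
  have i1 : Integrable (fun ω => (X ω - Z ω) ^ 2) P := (hX.sub hZ2).integrable_sq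
  have i2 : Integrable (fun ω => (Z ω - f (Y ω)) * X ω) P := hD2.integrable_mul hX
  have i3 : Integrable (fun ω => (Z ω - f (Y ω)) * Z ω) P := hD2.integrable_mul hZ2
  have i4 : Integrable (fun ω => (Z ω - f (Y ω)) ^ 2) P := hD2.integrable_sq
  have e : ∀ ω, (X ω - f (Y ω)) ^ 2 = (X ω - Z ω) ^ 2 +
      2 * ((Z ω - f (Y ω)) * X ω - (Z ω - f (Y ω)) * Z ω) + (Z ω - f (Y ω)) ^ 2 :=
    fun ω => by ring
  simp only [e]
  have i5 : Integrable (fun ω => 2 * ((Z ω - f (Y ω)) * X ω - (Z ω - f (Y ω)) * Z ω)) P :=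
    (i2.sub i3).const_mul 2
  have i15 : Integrable (fun ω => (X ω - Z ω) ^ 2 +
      2 * ((Z ω - f (Y ω)) * X ω - (Z ω - f (Y ω)) * Z ω)) P := i1.add i5
  simp only [Pi.sub_apply] at h
  rw [integral_add i15 i4, integral_add i1 i5, integral_const_mul,
    integral_sub i2 i3, h, sub_self, mul_zero, add_zero]
  have := integral_nonneg (μ := P) (f := fun ω => (Z ω - f (Y ω)) ^ 2) fun _ => sq_nonneg _
  unfold mmse
  linarith

/-- An estimator of infinite error satisfies the bound trivially, so square integrability can be
dropped. This matters for the estimators with frozen noise in `mmse_antitone_gain`. -/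
lemma mmse_le_lintegral (hX : MemLp X 2 P) (hY : Measurable Y) {f : ℝ → ℝ} (hf : Measurable f) :
    ENNReal.ofReal (mmse X Y P) ≤ ∫⁻ ω, ENNReal.ofReal ((X ω - f (Y ω)) ^ 2) ∂P := by
  have hm : AEStronglyMeasurable (fun ω => X ω - f (Y ω)) P :=
    hX.1.sub (hf.comp hY).aestronglyMeasurable
  by_cases hfin : ∫⁻ ω, ENNReal.ofReal ((X ω - f (Y ω)) ^ 2) ∂P = ⊤
  · simp [hfin]
  · have hi : Integrable (fun ω => (X ω - f (Y ω)) ^ 2) P := by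
      refine ⟨hm.pow 2, ?_⟩
      rw [hasFiniteIntegral_iff_ofReal (ae_of_all _ fun _ => sq_nonneg _)]
      exact lt_top_iff_ne_top.2 hfin
    have hD : MemLp (fun ω => X ω - f (Y ω)) 2 P := (memLp_two_iff_integrable_sq hm).2 hi
    have hf2 : MemLp (fun ω => f (Y ω)) 2 P := by
      have := hX.sub hD
      refine this.ae_eq (ae_of_all _ fun ω => ?_)
      simp
    rw [← ofReal_integral_eq_lintegral_ofReal hi (ae_of_all _ fun _ => sq_nonneg _)]
    exact ENNReal.ofReal_le_ofReal (mmse_le hX hY hf hf2)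

end Mmse

lemma gaussianReal_prod_map_rotation {a b : ℝ} (hab : a ^ 2 + b ^ 2 = 1) :
    ((gaussianReal 0 1).prod (gaussianReal 0 1)).map (fun p => a * p.1 + b * p.2) =
      gaussianReal 0 1 := by
  have h : gaussianReal 0 1 =
      ((gaussianReal 0 1).map (fun x => a * x)) ∗ ((gaussianReal 0 1).map (fun x => b * x)) := by
    rw [gaussianReal_map_const_mul, gaussianReal_map_const_mul, gaussianReal_conv_gaussianReal]
    congr 1
    · simp
    · ext; simp [hab]
  conv_rhs => rw [h]
  rw [Measure.conv, Measure.map_prod_map _ _ (by fun_prop) (by fun_prop),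
    Measure.map_map (by fun_prop) (by fun_prop)]
  rfl

/-- The observation at gain `c * b` is a degraded version of the observation at gain `b`. -/
lemma mmse_antitone_gain {π : Measure ℝ} [IsProbabilityMeasure π] (h2 : MemLp (fun x : ℝ => x) 2 π)
    {b c d : ℝ} (hcd : c ^ 2 + d ^ 2 = 1) :
    mmse Prod.fst (fun z => b * z.1 + z.2) (channelLaw π) ≤
      mmse Prod.fst (fun z => (c * b) * z.1 + z.2) (channelLaw π) := by
  have hX : MemLp (Prod.fst : ℝ × ℝ → ℝ) 2 (channelLaw π) :=
    h2.comp_measurePreserving (measurePreserving_fst (μ := π) (ν := gaussianReal 0 1))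
  have hY1 : Measurable (fun z : ℝ × ℝ => (c * b) * z.1 + z.2) := by fun_prop
  have hYb : Measurable (fun z : ℝ × ℝ => b * z.1 + z.2) := by fun_prop
  obtain ⟨g, hg, hgeq⟩ := (stronglyMeasurable_condExp (μ := channelLaw π) (f := Prod.fst)
    (m := MeasurableSpace.comap (fun z : ℝ × ℝ => (c * b) * z.1 + z.2)
      inferInstance)).measurable.exists_eq_measurable_comp
  have hg' : Measurable (fun q : ℝ × ℝ => ENNReal.ofReal ((q.1 - g (c * b * q.1 + q.2)) ^ 2)) :=
    ((measurable_fst.sub (hg.comp hY1)).pow_const 2).ennreal_ofReal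
  have e1 : ENNReal.ofReal (mmse Prod.fst (fun z => (c * b) * z.1 + z.2) (channelLaw π)) =
      ∫⁻ z, ENNReal.ofReal ((z.1 - g (c * b * z.1 + z.2)) ^ 2) ∂(channelLaw π) := by
    unfold mmse
    rw [ofReal_integral_eq_lintegral_ofReal]
    · refine lintegral_congr fun z => ?_
      rw [hgeq]; rfl
    · exact (hX.sub (hX.condExp (by norm_num))).integrable_sq
    · exact ae_of_all _ fun _ => sq_nonneg _
  refine (ENNReal.ofReal_le_ofReal_iff mmse_nonneg).1 ?_
  rw [e1, channelLaw, lintegral_prod _ hg'.aemeasurable]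
  -- The unit noise is split as `c n + d m`, so that the weaker observation becomes `c (b x + n) + d
  -- m`.
  have e2 : ∀ x : ℝ, ∫⁻ n, ENNReal.ofReal ((x - g (c * b * x + n)) ^ 2) ∂(gaussianReal 0 1) =
      ∫⁻ m, ∫⁻ n, ENNReal.ofReal ((x - g (c * b * x + (c * n + d * m))) ^ 2) ∂(gaussianReal 0 1)
        ∂(gaussianReal 0 1) := by
    intro x
    have hm : Measurable (fun n => ENNReal.ofReal ((x - g (c * b * x + n)) ^ 2)) :=
      hg'.comp (by fun_prop : Measurable fun n : ℝ => (x, n))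
    have hr : Measurable (fun p : ℝ × ℝ => c * p.1 + d * p.2) := by fun_prop
    conv_lhs => rw [← gaussianReal_prod_map_rotation hcd]
    rw [lintegral_map hm hr]
    exact lintegral_prod_symm _ (hm.comp hr).aemeasurable
  have hbig : Measurable (fun q : ℝ × ℝ × ℝ =>
      ENNReal.ofReal ((q.1 - g (c * b * q.1 + (c * q.2.2 + d * q.2.1))) ^ 2)) :=
    hg'.comp (by fun_prop : Measurable fun q : ℝ × ℝ × ℝ => (q.1, c * q.2.2 + d * q.2.1))
  simp only [e2]
  rw [lintegral_lintegral_swap]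
  -- For frozen `m`, `y ↦ g (c y + d m)` is an estimator based on the stronger observation alone,
  -- hence no better than the optimal one; averaging over `m` concludes.
  · have key : ∀ m : ℝ, ENNReal.ofReal (mmse Prod.fst (fun z => b * z.1 + z.2) (channelLaw π)) ≤
        ∫⁻ x, ∫⁻ n, ENNReal.ofReal ((x - g (c * b * x + (c * n + d * m))) ^ 2)
          ∂(gaussianReal 0 1) ∂π := by
      intro m
      have hfm : Measurable (fun y => g (c * y + d * m)) := hg.comp (by fun_prop)
      refine (mmse_le_lintegral hX hYb hfm).trans (le_of_eq ?_)
      have hz : Measurable (fun z : ℝ × ℝ =>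
          ENNReal.ofReal ((z.1 - g (c * (b * z.1 + z.2) + d * m)) ^ 2)) :=
        ((measurable_fst.sub (hfm.comp hYb)).pow_const 2).ennreal_ofReal
      rw [channelLaw, lintegral_prod _ hz.aemeasurable]
      refine lintegral_congr fun x => lintegral_congr fun n => ?_
      ring_nf
    calc _ = ∫⁻ _, ENNReal.ofReal (mmse Prod.fst (fun z => b * z.1 + z.2) (channelLaw π))
          ∂(gaussianReal 0 1) := by simp [channelLaw]
      _ ≤ _ := lintegral_mono key
  · have : Measurable (fun r : (ℝ × ℝ) × ℝ =>
        ENNReal.ofReal ((r.1.1 - g (c * b * r.1.1 + (c * r.2 + d * r.1.2))) ^ 2)) :=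
      hbig.comp (by fun_prop : Measurable fun r : (ℝ × ℝ) × ℝ => (r.1.1, r.1.2, r.2))
    exact this.lintegral_prod_right'.aemeasurable

lemma memLp_channelLaw_signal {π : Measure ℝ} (h2 : MemLp (fun x : ℝ => x) 2 π) :
    MemLp (fun z : ℝ × ℝ => z.1) 2 (channelLaw π) :=
  h2.comp_measurePreserving (measurePreserving_fst (μ := π) (ν := gaussianReal 0 1))

/-! ### Moments under the replica law and Gibbs' inequality -/

section ReplicaMoments

variable (π : Measure ℝ) [IsProbabilityMeasure π] (a : ℝ)

lemma integral_replicaLaw_fst {f : ℝ × ℝ → ℝ} (hf : Measurable f) :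
    ∫ p, f p.1 ∂(replicaLaw π a) = ∫ z, f z ∂(channelLaw π) := by
  rw [← replicaLaw_map_fst π a, integral_map (by fun_prop) hf.aestronglyMeasurable]

lemma integral_replicaLaw_resample {f : ℝ × ℝ → ℝ} (hf : Measurable f) :
    ∫ p, f (p.2, a * p.1.1 + p.1.2) ∂(replicaLaw π a) =
      ∫ z, f (z.1, a * z.1 + z.2) ∂(channelLaw π) := by
  have h1 := integral_map (μ := replicaLaw π a)
    (φ := fun p : (ℝ × ℝ) × ℝ => (p.2, a * p.1.1 + p.1.2)) (by fun_prop) hf.aestronglyMeasurable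
  have h2 := integral_map (μ := channelLaw π)
    (φ := fun z : ℝ × ℝ => (z.1, a * z.1 + z.2)) (by fun_prop) hf.aestronglyMeasurable
  rw [replicaLaw_map_resample] at h1
  exact h1.symm.trans h2

variable {π}

variable (π) in
lemma memLp_channelLaw_noise : MemLp (fun z : ℝ × ℝ => z.2) 2 (channelLaw π) :=
  (memLp_id_gaussianReal (μ := 0) (v := 1) 2).comp_measurePreserving
    (measurePreserving_snd (μ := π) (ν := gaussianReal 0 1))

lemma measurePreserving_replicaLaw_fst :
    MeasurePreserving Prod.fst (replicaLaw π a) (channelLaw π) :=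
  ⟨measurable_fst, replicaLaw_map_fst π a⟩

lemma measurePreserving_replicaLaw_snd :
    MeasurePreserving (fun p : (ℝ × ℝ) × ℝ => p.2) (replicaLaw π a) π := by
  refine ⟨measurable_snd, ?_⟩
  have : (fun p : (ℝ × ℝ) × ℝ => p.2) =
    Prod.fst ∘ (fun p : (ℝ × ℝ) × ℝ => (p.2, a * p.1.1 + p.1.2)) := rfl
  rw [this, ← Measure.map_map measurable_fst (by fun_prop), replicaLaw_map_resample, jointLaw,
    Measure.map_map measurable_fst (by fun_prop)]
  exact (measurePreserving_fst (μ := π) (ν := gaussianReal 0 1)).map_eq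

lemma memLp_replicaLaw_signal (h2 : MemLp (fun x : ℝ => x) 2 π) :
    MemLp (fun p : (ℝ × ℝ) × ℝ => p.1.1) 2 (replicaLaw π a) :=
  (memLp_channelLaw_signal h2).comp_measurePreserving (measurePreserving_replicaLaw_fst a)

lemma memLp_replicaLaw_noise : MemLp (fun p : (ℝ × ℝ) × ℝ => p.1.2) 2 (replicaLaw π a) :=
  (memLp_channelLaw_noise π).comp_measurePreserving (measurePreserving_replicaLaw_fst a)

lemma memLp_replicaLaw_sample (h2 : MemLp (fun x : ℝ => x) 2 π) :
    MemLp (fun p : (ℝ × ℝ) × ℝ => p.2) 2 (replicaLaw π a) :=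
  h2.comp_measurePreserving (measurePreserving_replicaLaw_snd a)

lemma integral_noise_sq : ∫ z, z.2 ^ 2 ∂(channelLaw π) = 1 := by
  have h := variance_fun_id_gaussianReal (μ := 0) (v := 1)
  rw [variance_eq_integral (by fun_prop)] at h
  simp only [integral_id_gaussianReal, sub_zero] at h
  rw [channelLaw, integral_fun_snd (μ := π) (ν := gaussianReal 0 1) (fun n : ℝ => n ^ 2), h]
  simp

lemma integral_signal_mul_noise : ∫ z, z.1 * z.2 ∂(channelLaw π) = 0 := by
  rw [channelLaw, integral_prod_mul (fun x : ℝ => x) (fun n : ℝ => n), integral_id_gaussianReal,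
    mul_zero]

lemma integral_signal_sq : ∫ z, z.1 ^ 2 ∂(channelLaw π) = ∫ x, x ^ 2 ∂π := by
  rw [channelLaw, integral_fun_fst (μ := π) (ν := gaussianReal 0 1) (fun n : ℝ => n ^ 2)]
  simp

/-- The conditional expectation of the signal is the posterior mean. -/
lemma condExp_signal (h2 : MemLp (fun x : ℝ => x) 2 π) :
    (fun z : ℝ × ℝ => ∫ x, x ∂(posteriorLaw π a (a * z.1 + z.2))) =ᵐ[channelLaw π]
      (channelLaw π)[Prod.fst |
        MeasurableSpace.comap (fun z : ℝ × ℝ => a * z.1 + z.2) inferInstance] := by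
  have hY : Measurable (fun z : ℝ × ℝ => a * z.1 + z.2) := by fun_prop
  have hR : Integrable (fun p : (ℝ × ℝ) × ℝ => p.2) (replicaLaw π a) :=
    (memLp_replicaLaw_sample a h2).integrable one_le_two
  have hi := integrable_integral_posteriorLaw π a hR
  have hmean : StronglyMeasurable (fun y => ∫ x, x ∂(posteriorLaw π a y)) := by
    simp only [integral_posteriorLaw]
    have : Measurable (fun p : ℝ × ℝ => posteriorDensity π a p.1 p.2 * p.2) :=
      ((measurable_posteriorDensity π a).comp measurable_swap).mul measurable_snd
    exact this.stronglyMeasurable.integral_prod_right'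
  refine ae_eq_condExp_of_forall_setIntegral_eq hY.comap_le
    ((memLp_channelLaw_signal h2).integrable one_le_two) (fun _ _ _ => hi.integrableOn) ?_ ?_
  · rintro _ ⟨B, hB, rfl⟩ -
    have hBm : MeasurableSet ((fun z : ℝ × ℝ => a * z.1 + z.2) ⁻¹' B) := hY hB
    have hF : Measurable (fun q : ℝ × ℝ => B.indicator (fun _ => (1 : ℝ)) q.2 * q.1) :=
      ((measurable_const.indicator hB).comp measurable_snd).mul measurable_fst
    have hI : Integrable (fun p : (ℝ × ℝ) × ℝ =>
        B.indicator (fun _ => (1 : ℝ)) (a * p.1.1 + p.1.2) * p.2) (replicaLaw π a) := by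
      refine hR.bdd_mul (c := 1) ?_ (ae_of_all _ fun p => ?_)
      · exact ((measurable_const.indicator hB).comp (by fun_prop)).aestronglyMeasurable
      · unfold Set.indicator; split_ifs <;> simp
    rw [← integral_indicator hBm, ← integral_indicator hBm]
    have e1 := integral_replicaLaw π a hI
    have e2 := integral_replicaLaw_resample π a hF
    calc _ = ∫ z, ∫ x, B.indicator (fun _ => (1 : ℝ)) (a * z.1 + z.2) * x
          ∂(posteriorLaw π a (a * z.1 + z.2)) ∂(channelLaw π) := by
          refine integral_congr_ae (ae_of_all _ fun z => ?_)
          by_cases hz : a * z.1 + z.2 ∈ B <;> simp [Set.indicator, hz]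
      _ = _ := e1.symm
      _ = _ := e2
      _ = _ := by
          refine integral_congr_ae (ae_of_all _ fun z => ?_)
          by_cases hz : a * z.1 + z.2 ∈ B <;> simp [Set.indicator, hz]
  · exact (hmean.measurable.comp (comap_measurable _)).aestronglyMeasurable

/-- Given the observation, the posterior sample is independent of the signal, so their overlap is
the correlation of the signal with its conditional mean. -/
lemma mmse_eq_sub_overlap (h2 : MemLp (fun x : ℝ => x) 2 π) :
    mmse Prod.fst (fun z => a * z.1 + z.2) (channelLaw π) =
      ∫ x, x ^ 2 ∂π - ∫ p, p.2 * p.1.1 ∂(replicaLaw π a) := by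
  have hX := memLp_channelLaw_signal h2
  have hRS : Integrable (fun p : (ℝ × ℝ) × ℝ => p.2 * p.1.1) (replicaLaw π a) :=
    (memLp_replicaLaw_sample a h2).integrable_mul (memLp_replicaLaw_signal a h2)
  have e := mmse_eq (P := channelLaw π) (X := Prod.fst) (Y := fun z : ℝ × ℝ => a * z.1 + z.2)
    hX (by fun_prop)
  rw [e, integral_signal_sq, integral_replicaLaw π a hRS]
  congr 1
  refine integral_congr_ae ?_
  filter_upwards [condExp_signal a h2] with z hz
  rw [← hz, integral_mul_const]

/-- Gibbs' variational inequality. -/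
lemma integral_le_log_integral_exp {α : Type*} [MeasurableSpace α] {ρ : Measure α}
    [IsProbabilityMeasure ρ] {f : α → ℝ} (hf : Integrable f ρ)
    (he : Integrable (fun x => Real.exp (f x)) ρ) :
    ∫ x, f x ∂ρ ≤ Real.log (∫ x, Real.exp (f x) ∂ρ) := by
  rw [Real.le_log_iff_exp_le (integral_exp_pos he)]
  exact convexOn_exp.map_integral_le Real.continuous_exp.continuousOn isClosed_univ
    (ae_of_all _ fun _ => Set.mem_univ _) hf he

/-- Under the posterior at gain `b`, the exponential of the change in log-likelihood averages to the
ratio of the evidences; Gibbs' inequality then applies. -/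
lemma integral_le_log_evidence_sub (b : ℝ) (y y' : ℝ)
    (hi : Integrable (fun x => logLik a y x - logLik b y' x) (posteriorLaw π b y')) :
    ∫ x, (logLik a y x - logLik b y' x) ∂(posteriorLaw π b y') ≤
      Real.log (evidence π a y) - Real.log (evidence π b y') := by
  have hb := integrable_exp_logLik π b y'
  have e : ∀ x, Real.exp (logLik b y' x) * Real.exp (logLik a y x - logLik b y' x) =
      Real.exp (logLik a y x) := fun x => by rw [← Real.exp_add]; ring_nf
  have he : Integrable (fun x => Real.exp (logLik a y x - logLik b y' x))
      (posteriorLaw π b y') := by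
    rw [posteriorLaw, integrable_tilted_iff hb]
    simp only [smul_eq_mul, e]
    exact integrable_exp_logLik π a y
  refine (integral_le_log_integral_exp hi he).trans (le_of_eq ?_)
  rw [← Real.log_div (evidence_pos π a y).ne' (evidence_pos π b y').ne', posteriorLaw,
    integral_exp_tilted (logLik b y') (fun x => logLik a y x - logLik b y' x)]
  simp [evidence]

end ReplicaMoments

/-! ### The I-MMSE tangent inequality -/

section Information

variable (π : Measure ℝ) [IsProbabilityMeasure π] (a b : ℝ)

lemma ae_integrable_posteriorLaw {f : (ℝ × ℝ) × ℝ → ℝ} (hf : Integrable f (replicaLaw π a)) :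
    ∀ᵐ z ∂(channelLaw π), Integrable (fun x => f (z, x)) (posteriorLaw π a (a * z.1 + z.2)) := by
  filter_upwards [((integrable_replicaLaw_iff π a).1 hf).prod_right_ae] with z hz
  rw [posteriorLaw, integrable_tilted_iff (integrable_exp_logLik π a _)]
  refine (hz.const_mul (evidence π a (a * z.1 + z.2))).congr (ae_of_all _ fun x => ?_)
  have := (evidence_pos π a (a * z.1 + z.2)).ne'
  simp only [posteriorDensity, smul_eq_mul]
  field_simp

variable {π}

/-- Jensen's inequality traps the logarithm between the prior mean of a quadratic form with finite
moments and `0`. -/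
lemma integrable_log_evidence (h2 : MemLp (fun x : ℝ => x) 2 π) :
    Integrable (fun z => Real.log (evidence π a (a * z.1 + z.2))) (channelLaw π) := by
  have hS : MemLp (fun p : (ℝ × ℝ) × ℝ => p.1.1) 2 ((channelLaw π).prod π) :=
    (memLp_channelLaw_signal h2).comp_measurePreserving measurePreserving_fst
  have hN : MemLp (fun p : (ℝ × ℝ) × ℝ => p.1.2) 2 ((channelLaw π).prod π) :=
    (memLp_channelLaw_noise π).comp_measurePreserving measurePreserving_fst
  have hR : MemLp (fun p : (ℝ × ℝ) × ℝ => p.2) 2 ((channelLaw π).prod π) :=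
    h2.comp_measurePreserving measurePreserving_snd
  have hL : MemLp (fun p : (ℝ × ℝ) × ℝ => a * p.1.1 + p.1.2 - a * p.2) 2 ((channelLaw π).prod π) :=
    ((hS.const_mul a).add hN).sub (hR.const_mul a)
  have hI : Integrable (fun p : (ℝ × ℝ) × ℝ => logLik a (a * p.1.1 + p.1.2) p.2)
      ((channelLaw π).prod π) := hL.integrable_sq.neg.div_const 2
  refine hI.integral_prod_left.mono ?_ ?_
  · exact ((measurable_evidence π a).comp (by fun_prop)).log.aestronglyMeasurable
  · filter_upwards [hI.prod_right_ae] with z hz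
    have h0 := Real.log_nonpos (evidence_pos π a (a * z.1 + z.2)).le (evidence_le_one π a _)
    have h1 := integral_le_log_integral_exp hz (integrable_exp_logLik π a _)
    rw [Real.norm_eq_abs, Real.norm_eq_abs, abs_of_nonpos h0, abs_of_nonpos (h1.trans h0)]
    exact neg_le_neg h1

lemma log_posteriorDensity (x n : ℝ) :
    Real.log (posteriorDensity π a (a * x + n) x) =
      -n ^ 2 / 2 - Real.log (evidence π a (a * x + n)) := by
  rw [posteriorDensity, Real.log_div (Real.exp_pos _).ne' (evidence_pos π a _).ne', Real.log_exp,
    logLik]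
  ring

lemma integrable_log_posteriorDensity (h2 : MemLp (fun x : ℝ => x) 2 π) :
    Integrable (fun z => Real.log (posteriorDensity π a (a * z.1 + z.2) z.1)) (channelLaw π) := by
  simp only [log_posteriorDensity]
  exact ((memLp_channelLaw_noise π).integrable_sq.neg.div_const 2).sub
    (integrable_log_evidence a h2)

lemma mutualInfo_eq_neg_log_evidence (h2 : MemLp (fun x : ℝ => x) 2 π) :
    mutualInfo Prod.fst (fun z => a * z.1 + z.2) (channelLaw π) =
      -1 / 2 - ∫ z, Real.log (evidence π a (a * z.1 + z.2)) ∂(channelLaw π) := by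
  have hn : Integrable (fun z : ℝ × ℝ => -z.2 ^ 2 / 2) (channelLaw π) :=
    (memLp_channelLaw_noise π).integrable_sq.neg.div_const 2
  rw [mutualInfo_eq_integral]
  simp only [log_posteriorDensity]
  rw [integral_sub hn (integrable_log_evidence a h2), integral_div, integral_neg, integral_noise_sq]

/-- The I-MMSE tangent inequality: both sides are equal to first order at `a = b`, so that it
determines the derivative of the mutual information in the gain. -/
lemma mul_mmse_le_mutualInfo_sub (h2 : MemLp (fun x : ℝ => x) 2 π) :
    (b - a) * a * mmse Prod.fst (fun z => b * z.1 + z.2) (channelLaw π) ≤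
      mutualInfo Prod.fst (fun z => b * z.1 + z.2) (channelLaw π) -
        mutualInfo Prod.fst (fun z => a * z.1 + z.2) (channelLaw π) := by
  have hS := memLp_replicaLaw_signal b h2
  have hN := memLp_replicaLaw_noise (π := π) b
  have hR := memLp_replicaLaw_sample b h2
  have iSS : Integrable (fun p : (ℝ × ℝ) × ℝ => p.1.1 ^ 2) (replicaLaw π b) := hS.integrable_sq
  have iRR : Integrable (fun p : (ℝ × ℝ) × ℝ => p.2 ^ 2) (replicaLaw π b) := hR.integrable_sq
  have iRS : Integrable (fun p : (ℝ × ℝ) × ℝ => p.2 * p.1.1) (replicaLaw π b) := hR.integrable_mul hS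
  have iSN : Integrable (fun p : (ℝ × ℝ) × ℝ => p.1.1 * p.1.2) (replicaLaw π b) :=
    hS.integrable_mul hN
  have iRN : Integrable (fun p : (ℝ × ℝ) × ℝ => p.2 * p.1.2) (replicaLaw π b) := hR.integrable_mul hN
  have eM := mmse_eq_sub_overlap b h2
  set M := mmse Prod.fst (fun z : ℝ × ℝ => b * z.1 + z.2) (channelLaw π)
  set V := ∫ x, x ^ 2 ∂π
  set q := ∫ p, p.2 * p.1.1 ∂(replicaLaw π b)
  have eSS : ∫ p, p.1.1 ^ 2 ∂(replicaLaw π b) = V := by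
    rw [integral_replicaLaw_fst π b (f := fun z => z.1 ^ 2) (by fun_prop), integral_signal_sq]
  have eSN : ∫ p, p.1.1 * p.1.2 ∂(replicaLaw π b) = 0 := by
    rw [integral_replicaLaw_fst π b (f := fun z => z.1 * z.2) (by fun_prop),
      integral_signal_mul_noise]
  have eRR : ∫ p, p.2 ^ 2 ∂(replicaLaw π b) = V := by
    have := integral_replicaLaw_resample π b (f := fun z => z.1 ^ 2) (by fun_prop)
    simp only at this
    rw [this, integral_signal_sq]
  -- The sample-noise correlation comes from comparing `E[sample · output]` with `E[signal ·
  -- output]`; the Nishimori identity replaces Gaussian integration by parts.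
  have eRN : ∫ p, p.2 * p.1.2 ∂(replicaLaw π b) = b * V - b * q := by
    have h1 := integral_replicaLaw_resample π b (f := fun z => z.1 * z.2) (by fun_prop)
    simp only at h1
    have e1 : ∀ p : (ℝ × ℝ) × ℝ, p.2 * (b * p.1.1 + p.1.2) = b * (p.2 * p.1.1) + p.2 * p.1.2 :=
      fun p => by ring
    have e2 : ∀ z : ℝ × ℝ, z.1 * (b * z.1 + z.2) = b * z.1 ^ 2 + z.1 * z.2 := fun z => by ring
    simp only [e1, e2] at h1
    have i0 : Integrable (fun z : ℝ × ℝ => z.1 * z.2) (channelLaw π) :=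
      (memLp_channelLaw_signal h2).integrable_mul (memLp_channelLaw_noise π)
    rw [integral_add (iRS.const_mul b) iRN, integral_const_mul, integral_add
      ((memLp_channelLaw_signal h2).integrable_sq.const_mul b) i0, integral_const_mul,
      integral_signal_sq, integral_signal_mul_noise] at h1
    linarith
  -- The two gains are coupled through the same signal and the same noise.
  have ed : ∀ p : (ℝ × ℝ) × ℝ,
      logLik a (a * p.1.1 + p.1.2) p.2 - logLik b (b * p.1.1 + p.1.2) p.2 =
        (b ^ 2 - a ^ 2) / 2 * (p.1.1 ^ 2 + p.2 ^ 2 - 2 * (p.2 * p.1.1)) +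
          (b - a) * (p.1.1 * p.1.2 - p.2 * p.1.2) := fun p => by unfold logLik; ring
  have i1 : Integrable (fun p : (ℝ × ℝ) × ℝ => p.1.1 ^ 2 + p.2 ^ 2) (replicaLaw π b) := iSS.add iRR
  have i2 : Integrable (fun p : (ℝ × ℝ) × ℝ => p.1.1 ^ 2 + p.2 ^ 2 - 2 * (p.2 * p.1.1))
    (replicaLaw π b) := i1.sub (iRS.const_mul 2)
  have i3 : Integrable (fun p : (ℝ × ℝ) × ℝ => p.1.1 * p.1.2 - p.2 * p.1.2)
    (replicaLaw π b) := iSN.sub iRN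
  have iD : Integrable (fun p : (ℝ × ℝ) × ℝ =>
      logLik a (a * p.1.1 + p.1.2) p.2 - logLik b (b * p.1.1 + p.1.2) p.2) (replicaLaw π b) := by
    simp only [ed]
    exact (i2.const_mul _).add (i3.const_mul _)
  have eD : ∫ p, (logLik a (a * p.1.1 + p.1.2) p.2 - logLik b (b * p.1.1 + p.1.2) p.2)
      ∂(replicaLaw π b) = (b - a) * a * M := by
    simp only [ed]
    rw [integral_add (i2.const_mul _) (i3.const_mul _), integral_const_mul, integral_const_mul,
      integral_sub i1 (iRS.const_mul 2), integral_add iSS iRR, integral_const_mul,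
      integral_sub iSN iRN, eSS, eRR, eSN, eRN, eM]
    ring
  rw [mutualInfo_eq_neg_log_evidence a h2, mutualInfo_eq_neg_log_evidence b h2, ← eD,
    integral_replicaLaw π b iD]
  have hsub := integral_sub (integrable_log_evidence a h2) (integrable_log_evidence b h2)
  have hmono := integral_mono_ae (integrable_integral_posteriorLaw π b iD)
    ((integrable_log_evidence a h2).sub (integrable_log_evidence b h2)) (by
      filter_upwards [ae_integrable_posteriorLaw π b iD] with z hz
      exact integral_le_log_evidence_sub a b _ _ hz)
  simp only [Pi.sub_apply] at hmono
  linarith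

end Information

/-! ### Bounds on the mutual information as a function of `s` -/

/-- A function whose increments are bounded above by a multiple of the squared step does not
increase. -/
lemma le_of_sub_le_sq {g : ℝ → ℝ} {K x y : ℝ} (hxy : x ≤ y)
    (h : ∀ u v, x ≤ u → u ≤ v → v ≤ y → g v - g u ≤ K * (v - u) ^ 2) : g y ≤ g x := by
  have key : ∀ n : ℕ, 0 < n → g y - g x ≤ K * (y - x) ^ 2 / n := by
    intro n hn
    have hn' : (0 : ℝ) < n := Nat.cast_pos.2 hn
    set d := (y - x) / n with hd
    have hd0 : 0 ≤ d := div_nonneg (sub_nonneg.2 hxy) hn'.le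
    have hnd : n * d = y - x := by rw [hd]; field_simp
    -- The `n` steps of length `d` cost `n K d² = K (y - x)² / n` in total, which vanishes as `n`
    -- grows.
    have step : ∀ k : ℕ, k ≤ n → g (x + k * d) - g x ≤ k * (K * d ^ 2) := by
      intro k
      induction k with
      | zero => intro _; simp
      | succ k ih =>
        intro hk
        have h1 := ih (by omega)
        have h2 := h (x + k * d) (x + (k + 1 : ℕ) * d)
          (le_add_of_nonneg_right (by positivity)) (by push_cast; linarith) (by
            have : ((k + 1 : ℕ) : ℝ) * d ≤ n * d :=
              mul_le_mul_of_nonneg_right (by exact_mod_cast hk) hd0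
            linarith)
        have e : x + ((k + 1 : ℕ) : ℝ) * d - (x + k * d) = d := by push_cast; ring
        rw [e] at h2
        push_cast at h2 ⊢
        linarith
    have h3 := step n le_rfl
    rw [hnd, add_sub_cancel] at h3
    refine h3.trans (le_of_eq ?_)
    rw [hd]; field_simp
  have hlim : Tendsto (fun n : ℕ => K * (y - x) ^ 2 / n) atTop (𝓝 0) :=
    tendsto_const_div_atTop_nhds_zero_nat _
  have := ge_of_tendsto hlim ((eventually_gt_atTop 0).mono fun n hn => key n hn)
  linarith

lemma miFun_nonneg (π : Measure ℝ) (s : ℝ) : 0 ≤ miFun π s := ENNReal.toReal_nonneg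

lemma mmseFun_nonneg (π : Measure ℝ) (s : ℝ) : 0 ≤ mmseFun π s := mmse_nonneg

lemma miFun_zero (π : Measure ℝ) [IsProbabilityMeasure π] : miFun π 0 = 0 := by
  have h := mutualInfo_eq_integral π 0
  have e : miFun π 0 = mutualInfo Prod.fst (fun z => 0 * z.1 + z.2) (channelLaw π) := by
    unfold miFun channelOutput; rw [Real.sqrt_zero]
  rw [e, h]
  have : ∀ z : ℝ × ℝ, posteriorDensity π 0 (0 * z.1 + z.2) z.1 = 1 := fun z => by
    have := (Real.exp_pos (-z.2 ^ 2 / 2)).ne'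
    simp [posteriorDensity, evidence, logLik]
  simp only [this, Real.log_one, integral_zero]

namespace IsCoeffDistribution

variable {π : Measure ℝ}

lemma integral_sq (h : IsCoeffDistribution π) : ∫ x, x ^ 2 ∂π = 1 := by
  have := h.variance
  rw [variance_eq_integral (by fun_prop)] at this
  simpa [h.mean] using this

lemma mmseFun_le_one (h : IsCoeffDistribution π) (s : ℝ) : mmseFun π s ≤ 1 := by
  have := h.isProbabilityMeasure
  have h1 := mmse_le (P := channelLaw π) (X := Prod.fst) (Y := channelOutput s) (f := fun _ => 0)
    (memLp_channelLaw_signal h.memLp) (by unfold channelOutput; fun_prop) measurable_const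
    (memLp_const 0)
  simp only [sub_zero] at h1
  rwa [integral_signal_sq, h.integral_sq] at h1

lemma mmseFun_antitone (h : IsCoeffDistribution π) {s t : ℝ} (hs : 0 ≤ s) (hst : s ≤ t) :
    mmseFun π t ≤ mmseFun π s := by
  have := h.isProbabilityMeasure
  rcases hs.eq_or_lt with rfl | hs'
  · have key := mmse_antitone_gain (π := π) h.memLp (b := √t) (c := 0) (d := 1) (by norm_num)
    rw [zero_mul] at key
    unfold mmseFun channelOutput
    rwa [Real.sqrt_zero]
  · have ht : 0 < t := hs'.trans_le hst
    have hd : 0 ≤ 1 - s / t := sub_nonneg.2 ((div_le_one ht).2 hst)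
    have key := mmse_antitone_gain (π := π) h.memLp (b := √t) (c := √(s / t)) (d := √(1 - s / t))
      (by rw [Real.sq_sqrt (by positivity), Real.sq_sqrt hd]; ring)
    rw [← Real.sqrt_mul (by positivity), div_mul_cancel₀ _ ht.ne'] at key
    exact key

lemma mul_mmseFun_le_miFun_sub (h : IsCoeffDistribution π) {s t : ℝ} (hs : 0 ≤ s) (hst : s ≤ t) :
    (t - s) / 2 * mmseFun π t ≤ miFun π t - miFun π s := by
  have := h.isProbabilityMeasure
  have ht := hs.trans hst
  set g : ℝ → ℝ := fun u => mmseFun π t * u ^ 2 / 2 - miFun π (u ^ 2) with hg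
  have key : g √t ≤ g √s := by
    -- In the gain variable, `(v² - u²)/2 - (v - u) u = (v - u)²/2` gives the constant.
    refine le_of_sub_le_sq (K := mmseFun π t / 2) (Real.sqrt_le_sqrt hst) fun u v hu huv hv => ?_
    have hu0 : 0 ≤ u := (Real.sqrt_nonneg s).trans hu
    have hv0 : 0 ≤ v := hu0.trans huv
    have h1 := mul_mmse_le_mutualInfo_sub (π := π) u v h.memLp
    have h2 : mmseFun π t ≤ mmseFun π (v ^ 2) :=
      h.mmseFun_antitone (sq_nonneg v) ((Real.le_sqrt hv0 ht).1 hv)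
    have e1 : mutualInfo Prod.fst (fun z => v * z.1 + z.2) (channelLaw π) = miFun π (v ^ 2) := by
      unfold miFun channelOutput; rw [Real.sqrt_sq hv0]
    have e2 : mutualInfo Prod.fst (fun z => u * z.1 + z.2) (channelLaw π) = miFun π (u ^ 2) := by
      unfold miFun channelOutput; rw [Real.sqrt_sq hu0]
    have e3 : mmse Prod.fst (fun z => v * z.1 + z.2) (channelLaw π) = mmseFun π (v ^ 2) := by
      unfold mmseFun channelOutput; rw [Real.sqrt_sq hv0]
    rw [e1, e2, e3] at h1
    have h3 := mul_le_mul_of_nonneg_left h2 (mul_nonneg (sub_nonneg.2 huv) hu0)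
    simp only [hg]
    linarith
  simp only [hg, Real.sq_sqrt ht, Real.sq_sqrt hs] at key
  linarith

lemma miFun_sub_le (h : IsCoeffDistribution π) {s t : ℝ} (hs : 0 ≤ s) (hst : s ≤ t) :
    miFun π t - miFun π s ≤ (t - s) / 2 := by
  have := h.isProbabilityMeasure
  have ht := hs.trans hst
  set g : ℝ → ℝ := fun u => miFun π (u ^ 2) - u ^ 2 / 2 with hg
  have key : g √t ≤ g √s := by
    refine le_of_sub_le_sq (K := 1 / 2) (Real.sqrt_le_sqrt hst) fun u v hu huv hv => ?_
    have hu0 : 0 ≤ u := (Real.sqrt_nonneg s).trans hu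
    have hv0 : 0 ≤ v := hu0.trans huv
    -- The tangent inequality with the gains exchanged bounds the increment from above.
    have h1 := mul_mmse_le_mutualInfo_sub (π := π) v u h.memLp
    have h2 := h.mmseFun_le_one (u ^ 2)
    have e1 : mutualInfo Prod.fst (fun z => v * z.1 + z.2) (channelLaw π) = miFun π (v ^ 2) := by
      unfold miFun channelOutput; rw [Real.sqrt_sq hv0]
    have e2 : mutualInfo Prod.fst (fun z => u * z.1 + z.2) (channelLaw π) = miFun π (u ^ 2) := by
      unfold miFun channelOutput; rw [Real.sqrt_sq hu0]
    have e3 : mmse Prod.fst (fun z => u * z.1 + z.2) (channelLaw π) = mmseFun π (u ^ 2) := by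
      unfold mmseFun channelOutput; rw [Real.sqrt_sq hu0]
    rw [e1, e2, e3] at h1
    have h3 := mul_le_mul_of_nonneg_left h2 (mul_nonneg (sub_nonneg.2 huv) hv0)
    simp only [hg]
    linarith
  simp only [hg, Real.sq_sqrt ht, Real.sq_sqrt hs] at key
  linarith

lemma miFun_le_half (h : IsCoeffDistribution π) {s : ℝ} (hs : 0 ≤ s) : miFun π s ≤ s / 2 := by
  have := h.isProbabilityMeasure
  have := h.miFun_sub_le le_rfl hs
  rw [miFun_zero] at this
  linarith

lemma half_mul_mmseFun_le_miFun (h : IsCoeffDistribution π) {s : ℝ} (hs : 0 ≤ s) :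
    s / 2 * mmseFun π s ≤ miFun π s := by
  have := h.isProbabilityMeasure
  have := h.mul_mmseFun_le_miFun_sub le_rfl hs
  rw [miFun_zero] at this
  linarith

lemma miFun_mono (h : IsCoeffDistribution π) {s t : ℝ} (hs : 0 ≤ s) (hst : s ≤ t) :
    miFun π s ≤ miFun π t := by
  have h1 := h.mul_mmseFun_le_miFun_sub hs hst
  have h2 := mul_nonneg (div_nonneg (sub_nonneg.2 hst) zero_le_two) (mmseFun_nonneg π t)
  linarith

lemma continuousOn_miFun (h : IsCoeffDistribution π) : ContinuousOn (miFun π) (Set.Ioi 0) := by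
  have : LipschitzOnWith 1 (miFun π) (Set.Ioi 0) := by
    refine LipschitzOnWith.of_le_add_mul 1 fun s hs t ht => ?_
    simp only [Set.mem_Ioi] at hs ht
    rw [NNReal.coe_one, one_mul, Real.dist_eq]
    rcases le_total s t with hst | hst
    · linarith [h.miFun_mono hs.le hst, abs_nonneg (s - t)]
    · linarith [h.miFun_sub_le ht.le hst, le_abs_self (s - t)]
  exact this.continuousOn

/-! ### Comparison with the entropy -/

lemma real_singleton_le_one (h : IsCoeffDistribution π) (x : ℝ) : π.real {x} ≤ 1 :=
  have := h.isProbabilityMeasure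
  measureReal_le_one

lemma negMulLog_nonneg (h : IsCoeffDistribution π) (x : ℝ) : 0 ≤ Real.negMulLog (π.real {x}) :=
  Real.negMulLog_nonneg measureReal_nonneg (h.real_singleton_le_one x)

/-- The evidence is at least the contribution of the atom `x` alone. -/
lemma log_posteriorDensity_le (h : IsCoeffDistribution π) (a y : ℝ) {x : ℝ}
    (hx : 0 < π.real {x}) : Real.log (posteriorDensity π a y x) ≤ -Real.log (π.real {x}) := by
  have := h.isProbabilityMeasure
  have hge : π.real {x} * Real.exp (logLik a y x) ≤ evidence π a y := by
    calc π.real {x} * Real.exp (logLik a y x) = ∫ u in {x}, Real.exp (logLik a y u) ∂π := by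
          simp [measureReal_def]
      _ ≤ _ := setIntegral_le_integral (integrable_exp_logLik π a y)
          (ae_of_all _ fun _ => (Real.exp_pos _).le)
  have hlog := Real.log_le_log (by positivity) hge
  rw [Real.log_mul hx.ne' (Real.exp_pos _).ne'] at hlog
  rw [posteriorDensity, Real.log_div (Real.exp_pos _).ne' (evidence_pos π a y).ne']
  linarith

lemma miFun_le_entropy (h : IsCoeffDistribution π) (s : ℝ) : miFun π s ≤ entropy π := by
  have := h.isProbabilityMeasure
  obtain ⟨S, hS, hS0⟩ := h.discrete
  have hI := integrable_log_posteriorDensity (π := π) (√s) h.memLp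
  have e : miFun π s = _ := mutualInfo_eq_integral π (√s)
  set G : ℝ → ℝ := fun x => ∫ n, Real.log (posteriorDensity π (√s) (√s * x + n) x)
    ∂(gaussianReal 0 1) with hG
  have hGi : Integrable G π := hI.integral_prod_left
  have e2 : miFun π s = ∫ x, G x ∂π := e.trans (integral_prod _ hI)
  have hGle : ∀ x, π.real {x} * G x ≤ Real.negMulLog (π.real {x}) := by
    intro x
    rcases measureReal_nonneg (μ := π) (s := {x}) |>.eq_or_lt with h0 | h0
    · simp [← h0]
    · have hl : Real.log (π.real {x}) ≤ 0 :=
        Real.log_nonpos measureReal_nonneg (h.real_singleton_le_one x)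
      have : G x ≤ -Real.log (π.real {x}) := by
        by_cases hi : Integrable (fun n => Real.log (posteriorDensity π (√s) (√s * x + n) x))
          (gaussianReal 0 1)
        · calc G x ≤ ∫ _, -Real.log (π.real {x}) ∂(gaussianReal 0 1) :=
              integral_mono hi (integrable_const _) fun n => h.log_posteriorDensity_le _ _ h0
            _ = _ := by simp
        -- A non-integrable integrand gives the default value `0`, still below the nonnegative
        -- bound.
        · simp only [hG]
          rw [integral_undef hi]
          linarith
      rw [Real.negMulLog]
      nlinarith
  have hres : π.restrict S = π := Measure.restrict_eq_self_of_ae_mem (by rwa [ae_iff])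
  have e3 := setIntegral_countable G hS hGi.integrableOn
  rw [hres] at e3
  rw [e2, e3]
  have hle : ∑' x : S, Real.negMulLog (π.real {(x : ℝ)}) ≤ entropy π :=
    h.finite_entropy.tsum_subtype_le _ S (fun x => h.negMulLog_nonneg x)
  refine le_trans ?_ hle
  have hsum : Summable fun x : S => Real.negMulLog (π.real {(x : ℝ)}) := h.finite_entropy.subtype S
  by_cases hs : Summable fun x : S => π.real {(x : ℝ)} • G x
  · exact hs.tsum_le_tsum (fun x => hGle x) hsum
  · rw [tsum_eq_zero_of_not_summable hs]
    exact tsum_nonneg fun x => h.negMulLog_nonneg x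

/-- Discreteness provides an atom, and unit variance prevents it from carrying all the mass. -/
lemma entropy_pos (h : IsCoeffDistribution π) : 0 < entropy π := by
  have := h.isProbabilityMeasure
  obtain ⟨S, hS, hS0⟩ := h.discrete
  obtain ⟨x, hx⟩ : ∃ x, π.real {x} ≠ 0 := by
    by_contra! hall
    have hz : π S = 0 := by
      rw [← Set.biUnion_of_singleton S, measure_biUnion_null_iff hS]
      exact fun x _ => (measureReal_eq_zero_iff).1 (hall x)
    have : π Set.univ ≤ π S + π Sᶜ := by
      rw [← Set.union_compl_self S]; exact measure_union_le _ _
    simp [hz, hS0] at this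
  have hx1 : π.real {x} ≠ 1 := by
    intro h1
    have hc : ∀ᵐ u ∂π, u = x := by
      have : π {x}ᶜ = 0 := by
        rw [prob_compl_eq_zero_iff (measurableSet_singleton x)]
        rw [measureReal_def] at h1
        rwa [ENNReal.toReal_eq_one_iff] at h1
      exact this
    have hv := h.variance
    have hc' : (fun u : ℝ => u) =ᵐ[π] fun _ => x := hc
    rw [variance_congr hc'] at hv
    simp [variance_eq_integral] at hv
  have hp0 : 0 < π.real {x} := lt_of_le_of_ne measureReal_nonneg hx.symm
  have hp1 : π.real {x} < 1 := lt_of_le_of_ne (h.real_singleton_le_one x) hx1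
  refine h.finite_entropy.tsum_pos (fun u => h.negMulLog_nonneg u) x ?_
  rw [Real.negMulLog]
  nlinarith [Real.log_neg hp0 hp1]

end IsCoeffDistribution

/-! ### Existence of extremal minimizers -/

/-- A continuous function on `(0, ∞)` blowing up at both ends has a smallest and a largest
minimizer. -/
lemma isLeast_isGreatest_minimizers {f : ℝ → ℝ} (hc : ContinuousOn f (Set.Ioi 0))
    (h0 : Tendsto f (𝓝[>] 0) atTop) (hinf : Tendsto f atTop atTop) :
    IsLeast {s | 0 < s ∧ ∀ u, 0 < u → f s ≤ f u} (sInf {s | 0 < s ∧ ∀ u, 0 < u → f s ≤ f u}) ∧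
    IsGreatest {s | 0 < s ∧ ∀ u, 0 < u → f s ≤ f u}
      (sSup {s | 0 < s ∧ ∀ u, 0 < u → f s ≤ f u}) := by
  obtain ⟨A, hA, hA'⟩ := mem_nhdsGT_iff_exists_Ioo_subset.1 (h0.eventually (eventually_gt_atTop (f 1)))
  obtain ⟨B, hB⟩ := eventually_atTop.1 (hinf.eventually (eventually_gt_atTop (f 1)))
  have hA0 : 0 < A := hA
  set K := Set.Icc (min A 1) (max B 1) with hK
  have hKpos : K ⊆ Set.Ioi 0 := fun x hx => (lt_min hA0 one_pos).trans_le hx.1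
  have h1K : (1 : ℝ) ∈ K := ⟨min_le_right _ _, le_max_right _ _⟩
  obtain ⟨m, hmK, hm⟩ := isCompact_Icc.exists_isMinOn (s := K) ⟨1, h1K⟩ (hc.mono hKpos)
  have hout : ∀ x, 0 < x → x ∉ K → f 1 < f x := by
    intro x hx hxK
    by_contra hle
    refine hxK ⟨?_, ?_⟩
    · by_contra hlt
      exact hle (hA' ⟨hx, (not_le.1 hlt).trans_le (min_le_left _ _)⟩)
    · by_contra hlt
      exact hle (hB x ((le_max_left _ _).trans (not_le.1 hlt).le))
  have hmin : ∀ u, 0 < u → f m ≤ f u := by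
    intro u hu
    by_cases huK : u ∈ K
    · exact hm huK
    · exact (hm h1K).trans (hout u hu huK).le
  -- Outside `K` the function exceeds its value at `1`, so the minimizers form a closed subset of a
  -- compact interval.
  have hset : {s | 0 < s ∧ ∀ u, 0 < u → f s ≤ f u} = K ∩ f ⁻¹' Set.Iic (f m) := by
    ext s
    constructor
    · rintro ⟨hs, hsu⟩
      refine ⟨?_, hsu m (hKpos hmK)⟩
      by_contra hsK
      exact absurd (hsu 1 one_pos) (not_le.2 (hout s hs hsK))
    · rintro ⟨hsK, hs⟩
      exact ⟨hKpos hsK, fun u hu => le_trans hs (hmin u hu)⟩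
  have hcomp : IsCompact {s | 0 < s ∧ ∀ u, 0 < u → f s ≤ f u} := by
    rw [hset]
    exact isCompact_Icc.of_isClosed_subset
      ((hc.mono hKpos).preimage_isClosed_of_isClosed isClosed_Icc isClosed_Iic)
      Set.inter_subset_left
  have hne : {s | 0 < s ∧ ∀ u, 0 < u → f s ≤ f u}.Nonempty := ⟨m, hKpos hmK, hmin⟩
  exact ⟨hcomp.isLeast_sInf hne, hcomp.isGreatest_sSup hne⟩

lemma phi_nonneg {x : ℝ} (hx : 0 < x) : 0 ≤ phi x := by
  have := Real.log_le_sub_one_of_pos hx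
  unfold phi; linarith

lemma half_sub_log_two_le_phi {x : ℝ} (hx : 0 < x) : x / 2 - Real.log 2 ≤ phi x := by
  have h := Real.log_le_sub_one_of_pos (half_pos hx)
  rw [Real.log_div hx.ne' two_ne_zero] at h
  unfold phi; linarith

/-- Convexity of `phi`, as a lower bound by the tangent of slope `-c` at `1 / (1 + c)`. -/
lemma log_one_add_le_mul_add_phi {x c : ℝ} (hx : 0 < x) (hc : 0 < c) :
    Real.log (1 + c) ≤ c * x + phi x := by
  have h1c : 0 < 1 + c := by linarith
  have h := Real.log_le_sub_one_of_pos (mul_pos h1c hx)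
  rw [Real.log_mul h1c.ne' hx.ne'] at h
  unfold phi; linarith

lemma tendsto_phi_atTop : Tendsto phi atTop atTop := by
  refine tendsto_atTop_mono' _ ((eventually_gt_atTop 0).mono fun x hx =>
    half_sub_log_two_le_phi hx) ?_
  exact tendsto_atTop_add_const_right _ _ (tendsto_id.atTop_div_const two_pos)

lemma tendsto_phi_nhdsGT_zero : Tendsto phi (𝓝[>] 0) atTop := by
  have h1 : Tendsto (fun x => -Real.log x + -1) (𝓝[>] 0) atTop :=
    tendsto_atTop_add_const_right _ _ (tendsto_neg_atBot_atTop.comp Real.tendsto_log_nhdsGT_zero)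
  refine tendsto_atTop_mono' _ ?_ h1
  filter_upwards [self_mem_nhdsWithin] with x hx
  have : (0 : ℝ) < x := hx
  unfold phi; linarith

lemma IsCoeffDistribution.isLeast_isGreatest_rsMinimizers {π : Measure ℝ}
    (h : IsCoeffDistribution π) {δ snr : ℝ} (hδ : 0 < δ) (hsnr : 0 < snr) :
    IsLeast (rsMinimizers π δ snr) (sLower π δ snr) ∧
      IsGreatest (rsMinimizers π δ snr) (sUpper π δ snr) := by
  have hd : 0 < δ * snr := mul_pos hδ hsnr
  have hle : ∀ s, δ / 2 * phi (s / (δ * snr)) ≤ rsPotential π δ snr s := fun s =>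
    le_add_of_nonneg_left (miFun_nonneg π s)
  refine isLeast_isGreatest_minimizers (f := rsPotential π δ snr) ?_ ?_ ?_
  · refine h.continuousOn_miFun.add (continuousOn_const.mul ?_)
    have hdiv : ContinuousOn (fun s : ℝ => s / (δ * snr)) (Set.Ioi 0) :=
      continuousOn_id.div_const _
    exact (hdiv.sub (hdiv.log fun s hs => (div_pos hs hd).ne')).sub continuousOn_const
  · refine tendsto_atTop_mono hle (Tendsto.const_mul_atTop (half_pos hδ)
      (tendsto_phi_nhdsGT_zero.comp ?_))
    refine tendsto_nhdsWithin_iff.2 ⟨?_, ?_⟩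
    · have : Tendsto (fun s : ℝ => s / (δ * snr)) (𝓝 0) (𝓝 (0 / (δ * snr))) :=
        tendsto_id.div_const _
      rw [zero_div] at this
      exact this.mono_left nhdsWithin_le_nhds
    · filter_upwards [self_mem_nhdsWithin] with s hs using div_pos hs hd
  · exact tendsto_atTop_mono hle (Tendsto.const_mul_atTop (half_pos hδ)
      (tendsto_phi_atTop.comp (tendsto_id.atTop_div_const hd)))

/-! ### Location of the minimizers relative to `2H` -/

namespace IsCoeffDistribution

variable {π : Measure ℝ} {δ snr s : ℝ}

lemma half_delta_mul_log (h : IsCoeffDistribution π) (hsnr : 0 < snr) :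
    δ / 2 * Real.log (1 + snr) = δ / deltaMMSE π snr * entropy π := by
  have h1 := h.entropy_pos.ne'
  have h2 : Real.log (1 + snr) ≠ 0 := (Real.log_pos (by linarith)).ne'
  unfold deltaMMSE
  field_simp

/-- The minimal value of the potential is at most `H` times the normalised sampling rate. -/
lemma rsPotential_le_of_mem_rsMinimizers (h : IsCoeffDistribution π) (hδ : 0 < δ)
    (hsnr : 0 < snr) (hs : s ∈ rsMinimizers π δ snr) :
    rsPotential π δ snr s ≤ δ / deltaMMSE π snr * entropy π := by
  have h1 : 0 < 1 + snr := by linarith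
  -- This point minimizes `s/2 + (δ/2) φ(s/(δ snr))`, the upper bound of the potential given by
  -- `I(s) ≤ s/2`; the minimum is `(δ/2) log(1 + snr)`.
  refine (hs.2 (δ * snr / (1 + snr)) (by positivity)).trans ?_
  have hI := h.miFun_le_half (s := δ * snr / (1 + snr)) (by positivity)
  have e : δ * snr / (1 + snr) / (δ * snr) = (1 + snr)⁻¹ := by field_simp
  rw [← h.half_delta_mul_log hsnr, rsPotential, e, phi, Real.log_inv]
  have e2 : δ * snr / (1 + snr) / 2 + δ / 2 * ((1 + snr)⁻¹ - 1) = 0 := by field_simp; ring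
  linarith

lemma rsPotential_le_entropy (h : IsCoeffDistribution π) (hδ : 0 < δ)
    (hsnr : 0 < snr) (hs : s ∈ rsMinimizers π δ snr) :
    rsPotential π δ snr s ≤ entropy π := by
  -- Here `φ` vanishes and only the mutual information remains.
  refine (hs.2 (δ * snr) (by positivity)).trans ?_
  have e : δ * snr / (δ * snr) = 1 := div_self (by positivity)
  simpa [rsPotential, e, phi] using h.miFun_le_entropy (δ * snr)

/-- Below the critical rate, minimizers stay below the entropy threshold. -/
lemma lt_of_ratio_lt (h : IsCoeffDistribution π) (hδ : 0 < δ) (hsnr : 0 < snr)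
    (hs : s ∈ rsMinimizers π δ snr) {t : ℝ} (ht : 0 ≤ t)
    (hr : δ / deltaMMSE π snr < t * mmseFun π (2 * entropy π * t)) : s < 2 * entropy π * t := by
  by_contra! hle
  have hH := h.entropy_pos
  have ht' : 0 ≤ 2 * entropy π * t := by positivity
  have h1 := h.rsPotential_le_of_mem_rsMinimizers hδ hsnr hs
  have h2 : miFun π s ≤ rsPotential π δ snr s :=
    le_add_of_nonneg_right (mul_nonneg (half_pos hδ).le (phi_nonneg (div_pos hs.1 (by positivity))))
  have h3 := h.miFun_mono ht' hle
  have h4 := h.half_mul_mmseFun_le_miFun ht'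
  have h5 := mul_lt_mul_of_pos_right hr hH
  linarith

/-- Above the critical rate, minimizers stay above the entropy threshold. -/
lemma lt_of_lt_ratio (h : IsCoeffDistribution π) (hδ : 0 < δ) (hsnr : 0 < snr)
    (hs : s ∈ rsMinimizers π δ snr) {t t' : ℝ} (ht : 0 ≤ t) (htt' : t ≤ t')
    (hr : 1 + t' < δ / deltaMMSE π snr + t * mmseFun π (2 * entropy π * t)) :
    2 * entropy π * t' < s := by
  by_contra! hle
  have hH := h.entropy_pos
  have ht0 : 0 ≤ 2 * entropy π * t := by positivity
  have htt : 2 * entropy π * t ≤ 2 * entropy π * t' :=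
    mul_le_mul_of_nonneg_left htt' (by positivity)
  have h1 := h.rsPotential_le_entropy hδ hsnr hs
  -- The slope `-snr` is chosen so that, after scaling by `δ/2`, the linear term is exactly `s/2`,
  -- to be absorbed by the growth bound on `I`.
  have h2 := log_one_add_le_mul_add_phi (div_pos hs.1 (mul_pos hδ hsnr)) hsnr
  have h3 := mul_le_mul_of_nonneg_left h2 (half_pos hδ).le
  rw [h.half_delta_mul_log hsnr] at h3
  have e : δ / 2 * (snr * (s / (δ * snr))) = s / 2 := by field_simp
  rw [mul_add, e] at h3
  have h4 := h.miFun_sub_le hs.1.le hle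
  have h5 := h.miFun_mono ht0 htt
  have h6 := h.half_mul_mmseFun_le_miFun ht0
  have h7 := mul_lt_mul_of_pos_right hr hH
  unfold rsPotential at h1
  linarith

end IsCoeffDistribution

end AllOrNothing

theorem theorem1 (π : ℝ → Measure ℝ) (δ snr : ℝ → ℝ) (r : ℝ)
    (hπ : ∀ ε : ℝ, 0 < ε → AllOrNothing.IsCoeffDistribution (π ε))
    (hstep : AllOrNothing.StepConvergence π)
    (hδ : ∀ ε : ℝ, 0 < ε → 0 < δ ε)
    (hsnr : ∀ ε : ℝ, 0 < ε → 0 < snr ε)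
    (hr : r ∈ Set.Ioo (0 : ℝ) 1 ∪ Set.Ioi (1 : ℝ))
    (hlim : Tendsto (fun ε => δ ε / AllOrNothing.deltaMMSE (π ε) (snr ε)) (𝓝[>] 0) (𝓝 r)) :
    (∀ ε : ℝ, 0 < ε →
      IsLeast (AllOrNothing.rsMinimizers (π ε) (δ ε) (snr ε))
        (AllOrNothing.sLower (π ε) (δ ε) (snr ε)) ∧
      IsGreatest (AllOrNothing.rsMinimizers (π ε) (δ ε) (snr ε))
        (AllOrNothing.sUpper (π ε) (δ ε) (snr ε))) ∧
    (r < 1 → Tendsto (fun ε => AllOrNothing.mmseFun (π ε)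
      (AllOrNothing.sUpper (π ε) (δ ε) (snr ε))) (𝓝[>] 0) (𝓝 1)) ∧
    (1 < r → Tendsto (fun ε => AllOrNothing.mmseFun (π ε)
      (AllOrNothing.sLower (π ε) (δ ε) (snr ε))) (𝓝[>] 0) (𝓝 0)) := by
  have hmin := fun ε (hε : 0 < ε) =>
    (hπ ε hε).isLeast_isGreatest_rsMinimizers (hδ ε hε) (hsnr ε hε)
  have hpos : ∀ᶠ ε : ℝ in 𝓝[>] 0, 0 < ε := self_mem_nhdsWithin
  refine ⟨hmin, fun hr1 => ?_, fun hr1 => ?_⟩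
  · have hr0 : 0 < r := by
      rcases hr with hr | hr
      · exact hr.1
      · exact one_pos.trans hr
    -- The largest minimizer eventually lies below `2Ht`, where the MMSE still tends to `1`.
    obtain ⟨t, hrt, ht1⟩ := exists_between hr1
    have ht0 : 0 ≤ t := (hr0.trans hrt).le
    have hM := hstep.1 t ht0 ht1
    have hMt : Tendsto (fun ε => t * AllOrNothing.mmseFun (π ε)
        (2 * AllOrNothing.entropy (π ε) * t)) (𝓝[>] 0) (𝓝 t) := by
      simpa using hM.const_mul t
    refine tendsto_of_tendsto_of_tendsto_of_le_of_le' hM tendsto_const_nhds ?_ ?_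
    · filter_upwards [hpos, hlim.eventually_lt hMt hrt] with ε hε hlt
      have hs := (hmin ε hε).2.1
      exact (hπ ε hε).mmseFun_antitone hs.1.le
        ((hπ ε hε).lt_of_ratio_lt (hδ ε hε) (hsnr ε hε) hs ht0 hlt).le
    · filter_upwards [hpos] with ε hε using (hπ ε hε).mmseFun_le_one _
  · obtain ⟨t', ht1', htr'⟩ := exists_between hr1
    -- Since `t' < r`, some `t < 1` satisfies `1 + t' < r + t`, the limiting form of the condition
    -- in `lt_of_lt_ratio`; the step hypothesis is used at `t` to bound `I` and at `t'` to conclude.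
    obtain ⟨t, ht, ht1⟩ : ∃ t, max 0 (1 + t' - r) < t ∧ t < 1 :=
      exists_between (max_lt one_pos (by linarith))
    have ht0 : 0 ≤ t := (le_max_left _ _).trans ht.le
    have hrt : 1 + t' < r + t := by linarith [(le_max_right 0 (1 + t' - r)).trans_lt ht]
    have hMt : Tendsto (fun ε => t * AllOrNothing.mmseFun (π ε)
        (2 * AllOrNothing.entropy (π ε) * t)) (𝓝[>] 0) (𝓝 t) := by
      simpa using (hstep.1 t ht0 ht1).const_mul t
    refine tendsto_of_tendsto_of_tendsto_of_le_of_le' tendsto_const_nhds (hstep.2 t' ht1') ?_ ?_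
    · exact Eventually.of_forall fun ε => AllOrNothing.mmseFun_nonneg _ _
    · filter_upwards [hpos, (hlim.add hMt).eventually_const_lt hrt] with ε hε hlt
      have hs := (hmin ε hε).1.1
      have hH := (hπ ε hε).entropy_pos
      exact (hπ ε hε).mmseFun_antitone (by positivity)
        ((hπ ε hε).lt_of_lt_ratio (hδ ε hε) (hsnr ε hε) hs ht0 (ht1.trans ht1').le hlt).le
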